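/- Let $F$ be a finitely generated field extension of $\mathbb{Q}$. An ordering of $F$ is a subset $P \subseteq F$ with $P + P \subseteq P$, $P \cdot P \subseteq P$, $P \cup -P = F$ and $-1 \notin P$; write $x \le_P y$ if $y - x \in P$. Let $X_F$ be the set of all orderings of $F$, equipped with the Harrison topology, i.e. the topology with subbasis the sets $H(a) = \{P \in X_F : a >_P 0\}$, $a \in F \setminus \{0\}$. An ordering $P$ is archimedean if for every $x \in F$ there is $n \in \mathbb{N}$ with $x \le_P n$. Then the set of archimedean orderings of $F$ is dense in $X_F$. -/

import Mathlib

/-- The space of orderings `X_F` of a field `F`: the subsets `P` of `F` that are closed under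
addition and multiplication, contain all squares, do not contain `-1` and satisfy `P ∪ -P = F`. -/
def OrderingSpace (F : Type*) [Field F] : Type _ :=
  {P : RingPreordering F // P.IsOrdering}

namespace OrderingSpace

/-- The Harrison set `H(a)` of the orderings `P` with `a >_P 0`. -/
def harrisonSet {F : Type*} [Field F] (a : F) : Set (OrderingSpace F) :=
  {P | a ∈ P.1 ∧ a ≠ 0}

/-- The Harrison topology: the Harrison sets `H(a)`, `a ≠ 0`, form a subbasis. -/
instance (F : Type*) [Field F] : TopologicalSpace (OrderingSpace F) :=
  TopologicalSpace.generateFrom {U | ∃ a : F, a ≠ 0 ∧ U = harrisonSet a}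

/-- An ordering `P` is archimedean if for every `x` there is a natural number `n`
with `x ≤_P n`, where `x ≤_P y` means `y - x ∈ P`. -/
def IsArchimedean {F : Type*} [Field F] (P : OrderingSpace F) : Prop :=
  ∀ x : F, ∃ n : ℕ, (n : F) - x ∈ P.1

end OrderingSpace

section

open Polynomial

/-! An embedding `σ : F → ℝ` pulls back to an archimedean ordering, so it suffices, given `P` and
finitely many `a >_P 0`, to find `σ` with all `σ a > 0`. Embed `(F, P)` into an ordered field `R`
with `PolynomialIVT`: by Artin–Schreier, a maximal cone in the algebraic closure provides one
(`exists_polynomialIVT_extension`). It remains to see that `R` induces on `F` a limit of real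
orderings (`IsRealLimit`).

This holds for `ℚ` and passes from a countable `K` to `K(x)` (`IsRealLimit.of_simple`). Real
embeddings approximating the ordering of `K` assemble into an order-preserving embedding of `K` into
an ultrapower of `ℝ`, which again satisfies `PolynomialIVT`. By `rootTransfer`, a form of the
uniqueness of real closures, points of `R` algebraic over `K` have counterparts there with the same
polynomial signs over `K`. Finitely many sign conditions then descend to one coordinate. If `x` is
algebraic, this yields a real root of its minimal polynomial satisfying the required inequalities.
If `x` is transcendental, it yields a real solution of strict inequalities, which can be moved to a
number transcendental over the countable field. -/

/-- Polynomials over `R` satisfy the intermediate value theorem. -/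
def PolynomialIVT (R : Type*) [Field R] [LinearOrder R] : Prop :=
  ∀ (p : R[X]) (a b : R), a < b → p.eval a * p.eval b < 0 → ∃ c, a < c ∧ c < b ∧ p.eval c = 0

/-! ### Rolle's theorem, root bounds and sign-changing factors -/

section OrderedField

variable {R : Type*} [Field R] [LinearOrder R] [IsStrictOrderedRing R]

/-- Without roots between `a` and `b`, a polynomial has the same sign at both. -/
theorem PolynomialIVT.pos_of_pos (hR : PolynomialIVT R) {p : R[X]} {a b : R}
    (h : ∀ c ∈ Set.uIcc a b, p.eval c ≠ 0) (ha : 0 < p.eval a) : 0 < p.eval b := by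
  by_contra hb
  have hb' : p.eval b < 0 := lt_of_le_of_ne (not_lt.1 hb) (h b Set.right_mem_uIcc)
  rcases lt_trichotomy a b with hab | rfl | hab
  · obtain ⟨c, h1, h2, h3⟩ := hR p a b hab (mul_neg_of_pos_of_neg ha hb')
    exact h c (by rw [Set.mem_uIcc]; left; exact ⟨h1.le, h2.le⟩) h3
  · exact hb ha
  · obtain ⟨c, h1, h2, h3⟩ := hR p b a hab (mul_neg_of_neg_of_pos hb' ha)
    exact h c (by rw [Set.mem_uIcc]; right; exact ⟨h1.le, h2.le⟩) h3

/-- Write `p = (X - a)^m (X - b)^k q` with `q` of the same sign at `a` and `b`. Then `p' = (X -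
a)^(m-1) (X - b)^(k-1) s`, where `s a = -m (b - a) q a` and `s b = k (b - a) q b` have opposite
signs. -/
theorem PolynomialIVT.rolle_of_consecutive (hR : PolynomialIVT R) {p : R[X]} (hp : p ≠ 0) {a b : R}
    (hab : a < b) (ha : p.eval a = 0) (hb : p.eval b = 0)
    (hc : ∀ c, a < c → c < b → p.eval c ≠ 0) :
    ∃ c, a < c ∧ c < b ∧ p.derivative.eval c = 0 := by
  obtain ⟨g, hg, hga⟩ := exists_eq_pow_rootMultiplicity_mul_and_not_dvd p hp a
  set m := p.rootMultiplicity a with hm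
  have hm0 : 0 < m := (rootMultiplicity_pos hp).2 ha
  have hg0 : g ≠ 0 := by rintro rfl; simp at hga
  obtain ⟨q, hq, hqb⟩ := exists_eq_pow_rootMultiplicity_mul_and_not_dvd g hg0 b
  set k := g.rootMultiplicity b with hk
  have hgb : g.eval b = 0 := by
    rw [hg] at hb
    simpa [sub_eq_zero, hab.ne'] using hb
  have hk0 : 0 < k := (rootMultiplicity_pos hg0).2 hgb
  rw [dvd_iff_isRoot, IsRoot.def] at hga hqb
  have hqa : q.eval a ≠ 0 := by
    intro h; apply hga; rw [hq]; simp [h]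
  have hqab : 0 < q.eval a * q.eval b := by
    by_contra hneg
    have : q.eval a * q.eval b < 0 := lt_of_le_of_ne (not_lt.1 hneg) (mul_ne_zero hqa hqb)
    obtain ⟨c, h1, h2, h3⟩ := hR q a b hab this
    exact hc c h1 h2 (by rw [hg, hq]; simp [h3])
  obtain ⟨m', hm'⟩ : ∃ m', m = m' + 1 := ⟨m - 1, by omega⟩
  obtain ⟨k', hk'⟩ : ∃ k', k = k' + 1 := ⟨k - 1, by omega⟩
  set s : R[X] := C (m : R) * (X - C b) * q + C (k : R) * (X - C a) * q
    + (X - C a) * (X - C b) * derivative q with hs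
  have hpd : derivative p = (X - C a) ^ m' * (X - C b) ^ k' * s := by
    rw [hg, hq, hm', hk']
    simp only [derivative_mul, derivative_X_sub_C_pow, hs, hm', hk', add_tsub_cancel_right]
    push_cast
    simp only [map_add, map_natCast, map_one]
    ring
  have hmk : s.eval a * s.eval b < 0 := by
    have h1 : s.eval a = -((m : R) * (b - a) * q.eval a) := by simp [hs]; ring
    have h2 : s.eval b = (k : R) * (b - a) * q.eval b := by simp [hs]
    have : s.eval a * s.eval b = -((m : R) * k * (b - a) ^ 2 * (q.eval a * q.eval b)) := by
      rw [h1, h2]; ring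
    rw [this, neg_lt_zero]
    have : 0 < b - a := sub_pos.2 hab
    positivity
  obtain ⟨c, h1, h2, h3⟩ := hR s a b hab hmk
  exact ⟨c, h1, h2, by rw [hpd]; simp [h3]⟩

/-- Rolle's theorem for polynomials. -/
theorem PolynomialIVT.rolle (hR : PolynomialIVT R) {p : R[X]} (hp : p ≠ 0) {a b : R}
    (hab : a < b) (ha : p.eval a = 0) (hb : p.eval b = 0) :
    ∃ c, a < c ∧ c < b ∧ p.derivative.eval c = 0 := by
  classical
  -- Replacing `b` by the first root after `a` reduces to consecutive roots.
  let T := p.roots.toFinset.filter (a < ·)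
  have hT : T.Nonempty := ⟨b, by simp [T, hp, hab, hb]⟩
  have h1 := T.min'_mem hT
  have h2 : T.min' hT ≤ b := T.min'_le b (by simp [T, hp, hab, hb])
  simp only [T, Finset.mem_filter, Multiset.mem_toFinset, mem_roots hp, IsRoot.def] at h1
  obtain ⟨c, hc1, hc2, hc3⟩ := hR.rolle_of_consecutive hp h1.2 ha h1.1 fun c hac hcb h0 =>
    not_le.2 hcb (T.min'_le c (by simp [T, hp, hac, h0]))
  exact ⟨c, hc1, hc2.trans_le h2, hc3⟩

/-- Roots are bounded in terms of the coefficients. -/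
theorem exists_abs_root_lt {K : Type*} [Field K] (i : K →+* R) {f : K[X]} (hf : f ≠ 0) {b : R}
    (hb : f.eval₂ i b = 0) : ∃ c : K, |b| < i c := by
  let d : ℕ → K := fun k => f.coeff k / f.leadingCoeff
  -- `K` carries no order, so `|d k|` is majorised by `d k ^ 2 + 1`, which makes sense in `K`. The
  -- summand `1 + 1` forces `|b| > 1` in the contrary case, so that powers of `|b|` increase.
  refine ⟨1 + 1 + ∑ k ∈ Finset.range f.natDegree, (d k ^ 2 + 1), ?_⟩
  simp only [map_add, map_one, map_sum, map_pow]
  by_contra hcon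
  push Not at hcon
  have hsum : 0 ≤ ∑ k ∈ Finset.range f.natDegree, (i (d k) ^ 2 + 1) :=
    Finset.sum_nonneg fun k _ => by positivity
  have hb1 : 1 < |b| := by linarith
  have hlc : i f.leadingCoeff ≠ 0 := by simpa using hf
  have hn : 0 < f.natDegree := by
    by_contra h0
    rw [eq_C_of_natDegree_eq_zero (by omega : f.natDegree = 0)] at hb hf
    simp at hb hf
    exact hf hb
  have heq : b ^ f.natDegree = -∑ k ∈ Finset.range f.natDegree, i (d k) * b ^ k := by
    rw [eval₂_eq_sum_range, Finset.sum_range_succ] at hb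
    have : ∑ k ∈ Finset.range f.natDegree, i (d k) * b ^ k
        = (∑ k ∈ Finset.range f.natDegree, i (f.coeff k) * b ^ k) / i f.leadingCoeff := by
      rw [Finset.sum_div]
      exact Finset.sum_congr rfl fun k _ => by simp only [d, map_div₀]; ring
    rw [this, eq_neg_of_add_eq_zero_left hb, coeff_natDegree]
    field_simp
  have hle : |b| ^ f.natDegree ≤
      (∑ k ∈ Finset.range f.natDegree, (i (d k) ^ 2 + 1)) * |b| ^ (f.natDegree - 1) := by
    rw [← abs_pow, heq, abs_neg, Finset.sum_mul]
    refine (Finset.abs_sum_le_sum_abs _ _).trans (Finset.sum_le_sum fun k hk => ?_)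
    rw [abs_mul, abs_pow]
    have h1 : |i (d k)| ≤ i (d k) ^ 2 + 1 := by
      rw [← sq_abs]; nlinarith [sq_nonneg (|i (d k)| - 1), abs_nonneg (i (d k))]
    have h2 : |b| ^ k ≤ |b| ^ (f.natDegree - 1) :=
      pow_le_pow_right₀ hb1.le (by have := Finset.mem_range.1 hk; omega)
    exact mul_le_mul h1 h2 (by positivity) (by positivity)
  have hpos : 0 < |b| ^ (f.natDegree - 1) := by positivity
  have : |b| ^ f.natDegree = |b| * |b| ^ (f.natDegree - 1) := by
    rw [← pow_succ']; congr 1; omega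
  rw [this] at hle
  have := le_of_mul_le_mul_right hle hpos
  linarith

/-- A polynomial that changes sign has an irreducible factor that changes sign. -/
theorem exists_irreducible_dvd_eval_mul_eval_neg {p : R[X]} {a b : R}
    (h : p.eval a * p.eval b < 0) :
    ∃ q, Irreducible q ∧ q ∣ p ∧ q.eval a * q.eval b < 0 := by
  induction p using WfDvdMonoid.induction_on_irreducible with
  | zero => simp at h
  | unit u hu =>
    obtain ⟨c, -, rfl⟩ := isUnit_iff.1 hu
    simp only [eval_C] at h
    exact absurd h (not_lt.2 (mul_self_nonneg c))
  | mul p q hp hq ih =>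
    by_cases hqs : q.eval a * q.eval b < 0
    · exact ⟨q, hq, dvd_mul_right _ _, hqs⟩
    · have : p.eval a * p.eval b < 0 := by
        by_contra hps
        rw [not_lt] at hqs hps
        refine not_lt.2 (mul_nonneg hqs hps) ?_
        simp only [eval_mul] at h
        linarith [h]
      obtain ⟨r, h1, h2, h3⟩ := ih this
      exact ⟨r, h1, h2.mul_left _, h3⟩

end OrderedField

/-! ### Intervals cut out by finite sets -/

section FiniteSets

variable {R : Type*} [Field R] [LinearOrder R] [IsStrictOrderedRing R] {K : Type*} [Field K]

/-- A point outside a finite set lies strictly between two neighbouring elements of that set,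
provided it lies between some two elements. -/
theorem Finset.exists_neighbours {R : Type*} [LinearOrder R] {T : Finset R}
    {b lo hi : R} (hlo : lo ∈ T) (hhi : hi ∈ T)
    (h1 : lo < b) (h2 : b < hi) (hb : b ∉ T) :
    ∃ c ∈ T, ∃ d ∈ T, c < b ∧ b < d ∧ ∀ x ∈ T, c < x → ¬ x < d := by
  have hl : (T.filter (· < b)).Nonempty := ⟨lo, by simp [hlo, h1]⟩
  have hh : (T.filter (b < ·)).Nonempty := ⟨hi, by simp [hhi, h2]⟩
  have hl' := Finset.max'_mem _ hl
  have hh' := Finset.min'_mem _ hh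
  simp only [Finset.mem_filter] at hl' hh'
  refine ⟨_, hl'.1, _, hh'.1, hl'.2, hh'.2, fun x hx hcx hxd => ?_⟩
  rcases lt_trichotomy x b with h | rfl | h
  · exact not_le.2 hcx (Finset.le_max' _ x (by simp [hx, h]))
  · exact hb hx
  · exact not_le.2 hxd (Finset.min'_le _ x (by simp [hx, h]))

/-- If a subfield contains a finite set `T`, then every point outside `T` can be joined to a point
of the subfield without meeting `T`. -/
theorem Finset.exists_uIcc_disjoint (i : K →+* R) {T : Finset R}
    (hT : ∀ x ∈ T, x ∈ i.range) {b : R}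
    (hb : b ∉ T) : ∃ m : K, ∀ x ∈ T, x ∉ Set.uIcc (i m) b := by
  by_cases hl : (T.filter (· < b)).Nonempty
  · have hl' := Finset.max'_mem _ hl
    have hl2 := Finset.le_max' (T.filter (· < b))
    set γ := (T.filter (· < b)).max' hl with hγ
    simp only [Finset.mem_filter] at hl'
    obtain ⟨c, hc⟩ := hT _ hl'.1
    by_cases hh : (T.filter (b < ·)).Nonempty
    · have hh' := Finset.min'_mem _ hh
      simp only [Finset.mem_filter] at hh'
      obtain ⟨u, hu, v, hv, hub, hbv, huv⟩ :=
        Finset.exists_neighbours hl'.1 hh'.1 hl'.2 hh'.2 hb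
      obtain ⟨u', rfl⟩ := hT _ hu
      obtain ⟨v', rfl⟩ := hT _ hv
      refine ⟨(u' + v') / 2, fun x hx hmem => ?_⟩
      have e : i ((u' + v') / 2) = (i u' + i v') / 2 := by simp [map_ofNat]
      rw [Set.mem_uIcc, e] at hmem
      apply huv x hx
      · rcases hmem with h | h <;> linarith [h.1]
      · rcases hmem with h | h <;> linarith [h.2]
    · refine ⟨c + 1, fun x hx hmem => ?_⟩
      rw [Set.mem_uIcc, map_add, map_one, hc] at hmem
      have hxb : ¬ b < x := fun h => hh ⟨x, by simp [hx, h]⟩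
      have hne : x ≠ b := by rintro rfl; exact hb hx
      have hlt : x < b := lt_of_le_of_ne (not_lt.1 hxb) hne
      have := hl2 x (by simp [hx, hlt])
      rcases hmem with h | h <;> linarith [h.1]
  · have hxb : ∀ x ∈ T, b < x := fun x hx => by
      have h1 : ¬ x < b := fun h => hl ⟨x, by simp [hx, h]⟩
      have hne : x ≠ b := by rintro rfl; exact hb hx
      exact lt_of_le_of_ne (not_lt.1 h1) hne.symm
    by_cases hh : T.Nonempty
    · have hm := Finset.min'_mem _ hh
      have hm2 := Finset.min'_le T
      obtain ⟨c, hc⟩ := hT _ hm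
      refine ⟨c - 1, fun x hx hmem => ?_⟩
      rw [Set.mem_uIcc, map_sub, map_one, hc] at hmem
      have := hm2 x hx
      have := hxb x hx
      rcases hmem with h | h <;> linarith [h.2]
    · exact ⟨0, fun x hx => absurd ⟨x, hx⟩ hh⟩

end FiniteSets

-- Transfer of algebraic points between ordered fields

universe u

/-- Two embeddings of `K` into ordered fields induce the same ordering. -/
def SameOrder {K R₁ R₂ : Type*} [Field K] [Field R₁] [LinearOrder R₁] [Field R₂] [LinearOrder R₂]
    (i₁ : K →+* R₁) (i₂ : K →+* R₂) : Prop :=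
  ∀ a, 0 < i₁ a ↔ 0 < i₂ a

/-- Polynomials over `K` have the same signs at `b₁` and `b₂`. -/
def SameSigns {K R₁ R₂ : Type*} [Field K] [Field R₁] [LinearOrder R₁] [Field R₂] [LinearOrder R₂]
    (i₁ : K →+* R₁) (i₂ : K →+* R₂) (b₁ : R₁) (b₂ : R₂) : Prop :=
  ∀ h : K[X], 0 < h.eval₂ i₁ b₁ ↔ 0 < h.eval₂ i₂ b₂

/-- A root of a nonzero polynomial is a root of an irreducible polynomial. -/
theorem exists_irreducible_eval₂_eq_zero {K S : Type*} [Field K] [CommRing S] [IsDomain S]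
    {i : K →+* S} {b : S} {f : K[X]} (hf : f ≠ 0) (hb : f.eval₂ i b = 0) :
    ∃ p : K[X], Irreducible p ∧ p.eval₂ i b = 0 := by
  by_contra hcon
  push Not at hcon
  induction f using WfDvdMonoid.induction_on_irreducible with
  | zero => exact hf rfl
  | unit u hu =>
    obtain ⟨c, hc, rfl⟩ := isUnit_iff.1 hu
    simp only [eval₂_C, map_eq_zero] at hb
    exact hc.ne_zero hb
  | mul p q hp hq ih =>
    rw [eval₂_mul] at hb
    exact (mul_eq_zero.1 hb).elim (hcon q hq) (ih hp)

theorem SameOrder.symm {K R₁ R₂ : Type*} [Field K] [Field R₁] [LinearOrder R₁] [Field R₂]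
    [LinearOrder R₂] {i₁ : K →+* R₁} {i₂ : K →+* R₂} (h : SameOrder i₁ i₂) : SameOrder i₂ i₁ :=
  fun a => (h a).symm

section Transfer

variable {R₁ R₂ : Type*} [Field R₁] [LinearOrder R₁] [IsStrictOrderedRing R₁]
  [Field R₂] [LinearOrder R₂] [IsStrictOrderedRing R₂]

theorem SameOrder.lt_iff {K : Type*} [Field K] {i₁ : K →+* R₁} {i₂ : K →+* R₂}
    (h : SameOrder i₁ i₂) (a b : K) : i₁ a < i₁ b ↔ i₂ a < i₂ b := by
  simpa using h (b - a)

theorem SameSigns.neg_iff {K : Type*} [Field K] {i₁ : K →+* R₁} {i₂ : K →+* R₂} {b₁ : R₁} {b₂ : R₂}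
    (hs : SameSigns i₁ i₂ b₁ b₂) (h : K[X]) : h.eval₂ i₁ b₁ < 0 ↔ h.eval₂ i₂ b₂ < 0 := by
  simpa using hs (-h)

theorem SameSigns.eq_zero_iff {K : Type*} [Field K] {i₁ : K →+* R₁} {i₂ : K →+* R₂} {b₁ : R₁}
    {b₂ : R₂} (hs : SameSigns i₁ i₂ b₁ b₂) (h : K[X]) :
    h.eval₂ i₁ b₁ = 0 ↔ h.eval₂ i₂ b₂ = 0 := by
  have h1 := hs h
  have h2 := hs.neg_iff h
  constructor <;> intro h0 <;> rw [h0] at h1 h2 <;> simp at h1 h2 <;>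
    exact le_antisymm (by assumption) (by assumption)

/-- Adjoining to `K` an algebraic point that has been transferred. -/
theorem SameSigns.exists_extension {K : Type u} [Field K] {i₁ : K →+* R₁} {i₂ : K →+* R₂} {b₁ : R₁}
    {b₂ : R₂} (hs : SameSigns i₁ i₂ b₁ b₂) {f : K[X]} (hf : f ≠ 0) (hb : f.eval₂ i₁ b₁ = 0) :
    ∃ (L : Type u) (_ : Field L) (j : K →+* L) (k₁ : L →+* R₁) (k₂ : L →+* R₂),
      SameOrder k₁ k₂ ∧ k₁.comp j = i₁ ∧ k₂.comp j = i₂ ∧ b₁ ∈ k₁.range := by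
  obtain ⟨p, hp, hpb⟩ := exists_irreducible_eval₂_eq_zero hf hb
  have := Fact.mk hp
  -- Equal signs make `p` vanish at `b₂` as well, so `K[X]/(p)` maps to both fields; agreement of
  -- signs on representatives is `SameOrder`.
  refine ⟨AdjoinRoot p, inferInstance, AdjoinRoot.of p, AdjoinRoot.lift i₁ b₁ hpb,
    AdjoinRoot.lift i₂ b₂ ((hs.eq_zero_iff p).1 hpb), fun a => ?_, ?_, ?_, ?_⟩
  · obtain ⟨h, rfl⟩ := AdjoinRoot.mk_surjective a
    rw [AdjoinRoot.lift_mk, AdjoinRoot.lift_mk]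
    exact hs h
  · ext; simp
  · ext; simp
  · exact ⟨AdjoinRoot.root p, by simp⟩

variable (R₁ R₂) in
/-- Points of `R₁` of degree less than `n` over a common subfield transfer to `R₂`. -/
def RootTransfer (n : ℕ) : Prop :=
  ∀ (K : Type u) [Field K] (i₁ : K →+* R₁) (i₂ : K →+* R₂), SameOrder i₁ i₂ →
    ∀ (b : R₁) (f : K[X]), f ≠ 0 → f.natDegree < n → f.eval₂ i₁ b = 0 →
      ∃ b' : R₂, SameSigns i₁ i₂ b b'

/-- The points are adjoined one at a time. Enlarging the base field keeps the degree bounds, and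
`RootTransfer` applies again because it quantifies over all base fields. -/
theorem RootTransfer.exists_extension {n : ℕ} (ht : RootTransfer.{u} R₁ R₂ n) (T : Finset R₁)
    {K : Type u} [Field K] {i₁ : K →+* R₁} {i₂ : K →+* R₂} (hi : SameOrder i₁ i₂)
    (hT : ∀ t ∈ T, ∃ f : K[X], f ≠ 0 ∧ f.natDegree < n ∧ f.eval₂ i₁ t = 0) :
    ∃ (L : Type u) (_ : Field L) (j : K →+* L) (k₁ : L →+* R₁) (k₂ : L →+* R₂),
      SameOrder k₁ k₂ ∧ k₁.comp j = i₁ ∧ k₂.comp j = i₂ ∧ ∀ t ∈ T, t ∈ k₁.range := by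
  classical
  induction T using Finset.induction_on with
  | empty => exact ⟨K, _, RingHom.id K, i₁, i₂, hi, rfl, rfl, by simp⟩
  | insert t T htT ih =>
    obtain ⟨L, _, j, k₁, k₂, hk, rfl, rfl, hr⟩ := ih fun t h => hT t (by simp [h])
    obtain ⟨f, hf, hfn, hft⟩ := hT t (by simp)
    have hft' : (f.map j).eval₂ k₁ t = 0 := by rwa [eval₂_map]
    have hf' : f.map j ≠ 0 := by rwa [Ne, Polynomial.map_eq_zero]
    obtain ⟨b', hb'⟩ := ht L k₁ k₂ hk t (f.map j) hf' (by rwa [natDegree_map]) hft'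
    obtain ⟨M, _, j', l₁, l₂, hl, rfl, rfl, hlr⟩ := hb'.exists_extension hf' hft'
    refine ⟨M, _, j'.comp j, l₁, l₂, hl, rfl, rfl, fun s hs => ?_⟩
    rcases Finset.mem_insert.1 hs with rfl | hs
    · exact hlr
    · obtain ⟨x, hx⟩ := hr s hs
      exact ⟨j' x, hx⟩

theorem RootTransfer.exists_extension_roots {n : ℕ} (ht : RootTransfer.{u} R₁ R₂ n)
    (S : Finset (Polynomial R₁)) {K : Type u} [Field K] {i₁ : K →+* R₁} {i₂ : K →+* R₂}
    (hi : SameOrder i₁ i₂)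
    (hP : ∀ q ∈ S, ∃ p : K[X], p.map i₁ = q ∧ p ≠ 0 ∧ p.natDegree < n) :
    ∃ (L : Type u) (_ : Field L) (j : K →+* L) (k₁ : L →+* R₁) (k₂ : L →+* R₂),
      SameOrder k₁ k₂ ∧ k₁.comp j = i₁ ∧ k₂.comp j = i₂ ∧
      ∀ q ∈ S, ∀ t, q.eval t = 0 → t ∈ k₁.range := by
  classical
  obtain ⟨L, _, j, k₁, k₂, hk, h1, h2, h3⟩ :=
    ht.exists_extension (S.biUnion fun q => q.roots.toFinset) hi (by
      intro t ht'
      simp only [Finset.mem_biUnion, Multiset.mem_toFinset] at ht'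
      obtain ⟨q, hq, hqt⟩ := ht'
      obtain ⟨p, rfl, hp0, hpn⟩ := hP q hq
      refine ⟨p, hp0, hpn, ?_⟩
      rw [eval₂_eq_eval_map]
      exact (mem_roots'.1 hqt).2)
  refine ⟨L, _, j, k₁, k₂, hk, h1, h2, fun q hq t hqt => h3 t ?_⟩
  obtain ⟨p, rfl, hp0, hpn⟩ := hP q hq
  simp only [Finset.mem_biUnion, Multiset.mem_toFinset]
  exact ⟨_, hq, by rw [mem_roots', IsRoot.def]; exact ⟨by simpa using hp0, hqt⟩⟩

/-- The roots in `R₁` and in `R₂` of finitely many polynomials of small degree can be adjoined. -/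
theorem RootTransfer.exists_extension_all_roots {n : ℕ} (h₁₂ : RootTransfer.{u} R₁ R₂ n)
    (h₂₁ : RootTransfer.{u} R₂ R₁ n)
    {K : Type u} [Field K] (S : Finset K[X]) {i₁ : K →+* R₁} {i₂ : K →+* R₂}
    (hi : SameOrder i₁ i₂) (hP : ∀ p ∈ S, p ≠ 0 ∧ p.natDegree < n) :
    ∃ (L : Type u) (_ : Field L) (j : K →+* L) (k₁ : L →+* R₁) (k₂ : L →+* R₂),
      SameOrder k₁ k₂ ∧ k₁.comp j = i₁ ∧ k₂.comp j = i₂ ∧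
      (∀ p ∈ S, ∀ t, p.eval₂ i₁ t = 0 → t ∈ k₁.range) ∧
      (∀ p ∈ S, ∀ t, p.eval₂ i₂ t = 0 → t ∈ k₂.range) := by
  classical
  obtain ⟨L, _, j, k₁, k₂, hk, rfl, rfl, hr₁⟩ :=
    h₁₂.exists_extension_roots (S.image (map i₁)) hi (by
      intro q hq
      obtain ⟨p, hp, rfl⟩ := Finset.mem_image.1 hq
      exact ⟨p, rfl, hP p hp⟩)
  obtain ⟨M, _, j', l₂, l₁, hl, rfl, rfl, hr₂⟩ :=
    h₂₁.exists_extension_roots (S.image (map (k₂.comp j))) hk.symm (by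
      intro q hq
      obtain ⟨p, hp, rfl⟩ := Finset.mem_image.1 hq
      refine ⟨p.map j, by rw [map_map], ?_, ?_⟩
      · simpa using (hP p hp).1
      · simpa using (hP p hp).2)
  refine ⟨M, _, j'.comp j, l₁, l₂, hl.symm, rfl, rfl, fun p hp t h => ?_, fun p hp t h => ?_⟩
  · obtain ⟨x, hx⟩ := hr₁ _ (Finset.mem_image_of_mem _ hp) t (by rwa [← eval₂_eq_eval_map])
    exact ⟨j' x, hx⟩
  · exact hr₂ _ (Finset.mem_image_of_mem _ hp) t (by rwa [← eval₂_eq_eval_map])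

/-- A separating family of polynomials of lower degree, for a point of minimal degree. -/
theorem exists_lower_degree_of_not_sameSigns {K : Type u} [Field K] {i₁ : K →+* R₁}
    {i₂ : K →+* R₂} {b : R₁} {b' : R₂} {f : K[X]} (hfb : f.eval₂ i₁ b = 0)
    (hfb' : f.eval₂ i₂ b' = 0)
    (hmin : ∀ g : K[X], g.natDegree < f.natDegree → g.eval₂ i₁ b = 0 → g = 0)
    (hn : 0 < f.natDegree)
    (hs : ¬ SameSigns i₁ i₂ b b') :
    ∃ h : K[X], h ≠ 0 ∧ h.natDegree < f.natDegree ∧ 0 < h.eval₂ i₁ b ∧ h.eval₂ i₂ b' ≤ 0 := by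
  unfold SameSigns at hs
  push Not at hs
  obtain ⟨h, hh⟩ := hs
  have hd : (h % f).natDegree < f.natDegree := natDegree_mod_lt h hn.ne'
  have e : h = f * (h / f) + h % f := (EuclideanDomain.div_add_mod h f).symm
  -- Reduction modulo `f` changes neither value, since `b` and `b'` are roots of `f`.
  have e₁ : h.eval₂ i₁ b = (h % f).eval₂ i₁ b := by
    conv_lhs => rw [e]
    simp [eval₂_add, eval₂_mul, hfb]
  have e₂ : h.eval₂ i₂ b' = (h % f).eval₂ i₂ b' := by
    conv_lhs => rw [e]
    simp [eval₂_add, eval₂_mul, hfb']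
  rw [e₁, e₂] at hh
  rcases hh with ⟨h1, h2⟩ | ⟨h1, h2⟩
  · exact ⟨h % f, by rintro h0; simp [h0] at h1, hd, h1, h2⟩
  · have h0 : h % f ≠ 0 := by rintro h0; simp [h0] at h2
    refine ⟨-(h % f), neg_ne_zero.2 h0, by rwa [natDegree_neg], ?_, ?_⟩
    · rw [eval₂_neg, neg_pos]
      exact lt_of_le_of_ne h1 fun h3 => h0 (hmin _ hd h3)
    · rw [eval₂_neg, neg_nonpos]
      exact h2.le

/-- A polynomial over a subfield changes sign around a root of minimal degree, as long as its
derivative has no roots. -/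
theorem eval_mul_eval_neg_of_minimal {K : Type u} [Field K] {i : K →+* R₁} (hR : PolynomialIVT R₁)
    {b : R₁} {f : K[X]} (hfb : f.eval₂ i b = 0)
    (hmin : ∀ g : K[X], g.natDegree < f.natDegree → g.eval₂ i b = 0 → g = 0)
    (hn : 0 < f.natDegree) {c d : K} (hc : i c < b) (hd : b < i d)
    (hder : ∀ x, i c < x → x < i d → (derivative f).eval₂ i x ≠ 0) :
    i (f.eval c) * i (f.eval d) < 0 := by
  have : CharZero K := (RingHom.charZero_iff i.injective).2 inferInstance
  have hf0 : f ≠ 0 := by rintro rfl; simp at hn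
  -- A root `e ≠ b` in `K` could be divided out, contradicting the minimality of `f`.
  have hne : ∀ e : K, i e ≠ b → f.eval e ≠ 0 := by
    intro e he h0
    obtain ⟨g, rfl⟩ := dvd_iff_isRoot.2 h0
    have hg0 : g ≠ 0 := right_ne_zero_of_mul hf0
    have hdeg : ((X - C e) * g).natDegree = 1 + g.natDegree := by
      rw [natDegree_mul (X_sub_C_ne_zero e) hg0, natDegree_X_sub_C]
    refine hg0 (hmin g (by omega) ?_)
    rw [eval₂_mul] at hfb
    refine (mul_eq_zero.1 hfb).resolve_left ?_
    simpa [sub_eq_zero] using he.symm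
  set F := f.map i with hF
  have hF0 : F ≠ 0 := by simpa [hF] using hf0
  have hFb : F.eval b = 0 := by rwa [hF, ← eval₂_eq_eval_map]
  have hFe : ∀ e, i (f.eval e) = F.eval (i e) := fun e => by rw [hF, eval_map_apply]
  have hder' : ∀ x, i c < x → x < i d → (derivative F).eval x ≠ 0 := by
    intro x h1 h2
    rw [hF, derivative_map, ← eval₂_eq_eval_map]
    exact hder x h1 h2
  by_contra hneg
  have hpos : 0 < i (f.eval c) * i (f.eval d) := by
    refine lt_of_le_of_ne (not_lt.1 hneg) (mul_ne_zero ?_ ?_).symm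
    · simpa using hne c hc.ne
    · simpa using hne d hd.ne'
  obtain ⟨g, hg⟩ := dvd_iff_isRoot.2 hFb
  rw [hFe, hFe, hg, eval_mul, eval_mul] at hpos
  simp only [eval_sub, eval_X, eval_C] at hpos
  -- If `F` had equal signs at the ends, `g = F / (X - b)` would change sign. A root of `g` is
  -- either a second root of `F`, handled by Rolle, or `b` itself, a double root; both give a root
  -- of the derivative.
  have hgneg : g.eval (i c) * g.eval (i d) < 0 := by
    by_contra h
    have h3 : 0 < (b - i c) * (i d - b) := mul_pos (sub_pos.2 hc) (sub_pos.2 hd)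
    nlinarith [mul_nonneg h3.le (not_lt.1 h)]
  obtain ⟨x, hx1, hx2, hx⟩ := hR g (i c) (i d) (hc.trans hd) hgneg
  have hFx : F.eval x = 0 := by rw [hg, eval_mul, hx, mul_zero]
  rcases lt_trichotomy x b with h | rfl | h
  · obtain ⟨y, h1, h2, h3⟩ := hR.rolle hF0 h hFx hFb
    exact hder' y (hx1.trans h1) (h2.trans hd) h3
  · exact hder' x hc hd (by rw [hg]; simp [hx])
  · obtain ⟨y, h1, h2, h3⟩ := hR.rolle hF0 h hFb hFx
    exact hder' y (hc.trans h1) (h2.trans hx2) h3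

/-- Suppose `b` has no counterpart. For every root `b'` of `f` in `R₂`, some `h b'` of lower degree
separates `b` from `b'`. After adjoining the roots in both fields of `f'` and all `h b'`, `b` lies
in an interval with endpoints in `L` on which none of these vanish, in either field. There `f`
changes sign, hence also in `R₂`, giving a root `b'`. But `h b'` has constant sign on the interval,
and this sign is the same in both fields, as the midpoint shows. -/
theorem RootTransfer.succ (hR₁ : PolynomialIVT R₁) (hR₂ : PolynomialIVT R₂) {n : ℕ}
    (h₁₂ : RootTransfer.{u} R₁ R₂ n) (h₂₁ : RootTransfer.{u} R₂ R₁ n) :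
    RootTransfer.{u} R₁ R₂ (n + 1) := by
  classical
  intro K _ i₁ i₂ hi b f hf hfn hfb
  by_contra hcon
  push Not at hcon
  -- Even over a larger field, `b` has no smaller degree: otherwise it would transfer by the
  -- induction hypothesis.
  have hmin_of : ∀ (L : Type u) [Field L] (j : K →+* L) (k₁ : L →+* R₁) (k₂ : L →+* R₂),
      SameOrder k₁ k₂ → k₁.comp j = i₁ → k₂.comp j = i₂ →
      ∀ g : L[X], g.natDegree < f.natDegree → g.eval₂ k₁ b = 0 → g = 0 := by
    intro L _ j k₁ k₂ hk e₁ e₂ g hg hgb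
    by_contra hg0
    obtain ⟨b', hb'⟩ := h₁₂ L k₁ k₂ hk b g hg0 (by omega) hgb
    refine hcon b' fun h => ?_
    rw [← e₁, ← e₂, ← eval₂_map, ← eval₂_map]
    exact hb' _
  have hmin := hmin_of K (RingHom.id K) i₁ i₂ hi rfl rfl
  have hn : 0 < f.natDegree := by
    by_contra h0
    rw [eq_C_of_natDegree_eq_zero (by omega : f.natDegree = 0)] at hfb hf
    simp at hfb hf
    exact hf hfb
  have : CharZero K := (RingHom.charZero_iff i₁.injective).2 inferInstance
  have hder0 : derivative f ≠ 0 := fun h => hn.ne' (derivative_eq_zero.1 h)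
  have hderdeg : (derivative f).natDegree < f.natDegree := natDegree_derivative_lt hn.ne'
  have hsep : ∀ b' : R₂, ∃ h : K[X], f.eval₂ i₂ b' = 0 →
      h ≠ 0 ∧ h.natDegree < f.natDegree ∧ 0 < h.eval₂ i₁ b ∧ h.eval₂ i₂ b' ≤ 0 := by
    intro b'
    by_cases hb' : f.eval₂ i₂ b' = 0
    · obtain ⟨h, hh⟩ := exists_lower_degree_of_not_sameSigns hfb hb' hmin hn (hcon b')
      exact ⟨h, fun _ => hh⟩
    · exact ⟨0, fun h => absurd h hb'⟩
  choose h hh using hsep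
  let S : Finset K[X] := insert (derivative f) ((f.map i₂).roots.toFinset.image h)
  have hS : ∀ p ∈ S, p ≠ 0 ∧ p.natDegree < f.natDegree := by
    intro p hp
    rcases Finset.mem_insert.1 hp with rfl | hp
    · exact ⟨hder0, hderdeg⟩
    · obtain ⟨b', hb', rfl⟩ := Finset.mem_image.1 hp
      have hb'' : f.eval₂ i₂ b' = 0 := by
        rw [eval₂_eq_eval_map]
        exact (mem_roots'.1 (Multiset.mem_toFinset.1 hb')).2
      exact ⟨(hh b' hb'').1, (hh b' hb'').2.1⟩
  obtain ⟨L, _, j, k₁, k₂, hk, rfl, rfl, hr₁, hr₂⟩ :=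
    h₁₂.exists_extension_all_roots h₂₁ S hi fun p hp => ⟨(hS p hp).1, by have := (hS p hp).2; omega⟩
  obtain ⟨M, hM⟩ := exists_abs_root_lt k₁ (f := f.map j) (by simpa using hf) (b := b)
    (by rwa [eval₂_map])
  obtain ⟨hM1, hM2⟩ := abs_lt.1 hM
  -- The points `±M` guarantee that `b` has a neighbour on each side.
  let T : Finset R₁ := insert (k₁ (-M)) (insert (k₁ M)
    (S.biUnion fun p => (p.map (k₁.comp j)).roots.toFinset))
  have hrootT : ∀ p ∈ S, ∀ x, p.eval₂ (k₁.comp j) x = 0 → x ∈ T := by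
    intro p hp x hx
    refine Finset.mem_insert_of_mem (Finset.mem_insert_of_mem (Finset.mem_biUnion.2 ⟨p, hp, ?_⟩))
    rw [Multiset.mem_toFinset, mem_roots', IsRoot.def, ← eval₂_eq_eval_map]
    exact ⟨by rw [Ne, Polynomial.map_eq_zero]; exact (hS p hp).1, hx⟩
  have hTrange : ∀ x ∈ T, x ∈ k₁.range := by
    intro x hx
    rcases Finset.mem_insert.1 hx with rfl | hx
    · exact ⟨_, rfl⟩
    rcases Finset.mem_insert.1 hx with rfl | hx
    · exact ⟨_, rfl⟩
    obtain ⟨p, hp, hpx⟩ := Finset.mem_biUnion.1 hx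
    refine hr₁ p hp x ?_
    rw [eval₂_eq_eval_map]
    exact (mem_roots'.1 (Multiset.mem_toFinset.1 hpx)).2
  have hbT : b ∉ T := by
    intro hx
    rcases Finset.mem_insert.1 hx with hx | hx
    · rw [hx] at hM1; simp at hM1
    rcases Finset.mem_insert.1 hx with hx | hx
    · rw [hx] at hM2; simp at hM2
    obtain ⟨p, hp, hpx⟩ := Finset.mem_biUnion.1 hx
    refine (hS p hp).1 (hmin p (hS p hp).2 ?_)
    rw [eval₂_eq_eval_map]
    exact (mem_roots'.1 (Multiset.mem_toFinset.1 hpx)).2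
  obtain ⟨c', hc', d', hd', hcb, hbd, hnb⟩ := Finset.exists_neighbours (T := T) (b := b)
    (lo := k₁ (-M)) (hi := k₁ M) (by simp [T]) (by simp [T]) (by simpa using hM1) hM2 hbT
  obtain ⟨c, rfl⟩ := hTrange c' hc'
  obtain ⟨d, rfl⟩ := hTrange d' hd'
  have hno₁ : ∀ p ∈ S, ∀ x, k₁ c < x → x < k₁ d → p.eval₂ (k₁.comp j) x ≠ 0 :=
    fun p hp x h1 h2 h0 => hnb x (hrootT p hp x h0) h1 h2
  have hno₂ : ∀ p ∈ S, ∀ x, k₂ c < x → x < k₂ d → p.eval₂ (k₂.comp j) x ≠ 0 := by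
    intro p hp x h1 h2 h0
    obtain ⟨y, rfl⟩ := hr₂ p hp x h0
    refine hno₁ p hp (k₁ y) ((hk.lt_iff _ _).2 h1) ((hk.lt_iff _ _).2 h2) ?_
    rw [← eval₂_map, eval₂_hom] at h0 ⊢
    rw [(map_eq_zero k₂).1 h0, map_zero]
  have hcd : k₂ c < k₂ d := (hk.lt_iff _ _).1 (hcb.trans hbd)
  have hsign : k₁ ((f.map j).eval c) * k₁ ((f.map j).eval d) < 0 := by
    refine eval_mul_eval_neg_of_minimal hR₁ (by rwa [eval₂_map]) ?_ ?_ hcb hbd ?_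
    · rw [natDegree_map]
      exact hmin_of L j k₁ k₂ hk rfl rfl
    · rwa [natDegree_map]
    · intro x h1 h2
      rw [derivative_map, eval₂_map]
      exact hno₁ _ (Finset.mem_insert_self _ _) x h1 h2
  have hsign₂ : k₂ ((f.map j).eval c) * k₂ ((f.map j).eval d) < 0 := by
    rw [← map_mul, ← neg_pos, ← map_neg] at hsign ⊢
    exact (hk _).1 hsign
  obtain ⟨b', hb1, hb2, hb0⟩ := hR₂ ((f.map j).map k₂) (k₂ c) (k₂ d) hcd
    (by rwa [eval_map_apply, eval_map_apply])
  have hfb' : f.eval₂ (k₂.comp j) b' = 0 := by rwa [eval₂_eq_eval_map, ← map_map]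
  obtain ⟨hp0, -, hpb, hpb'⟩ := hh b' hfb'
  have hp : h b' ∈ S := by
    refine Finset.mem_insert_of_mem (Finset.mem_image_of_mem _ ?_)
    rw [Multiset.mem_toFinset, mem_roots', IsRoot.def, ← eval₂_eq_eval_map]
    exact ⟨by rw [Ne, Polynomial.map_eq_zero]; exact hf, hfb'⟩
  set m := (c + d) / 2 with hm
  have hm₁ : k₁ m = (k₁ c + k₁ d) / 2 := by simp [hm, map_ofNat]
  have hm₂ : k₂ m = (k₂ c + k₂ d) / 2 := by simp [hm, map_ofNat]
  have hpm₁ : 0 < ((h b').map (k₁.comp j)).eval (k₁ m) := by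
    refine hR₁.pos_of_pos (a := b) (fun x hx => ?_) (by rwa [← eval₂_eq_eval_map])
    rw [← eval₂_eq_eval_map]
    rw [Set.mem_uIcc] at hx
    refine hno₁ _ hp x ?_ ?_
    · rcases hx with hx | hx <;> linarith [hx.1]
    · rcases hx with hx | hx <;> linarith [hx.2]
  have hpm₂ : 0 < ((h b').map (k₂.comp j)).eval (k₂ m) := by
    rw [← map_map, eval_map_apply] at hpm₁ ⊢
    exact (hk _).1 hpm₁
  refine not_lt.2 hpb' ?_
  rw [eval₂_eq_eval_map]
  refine hR₂.pos_of_pos (a := k₂ m) (fun x hx => ?_) hpm₂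
  rw [← eval₂_eq_eval_map]
  rw [Set.mem_uIcc] at hx
  refine hno₂ _ hp x ?_ ?_
  · rcases hx with hx | hx <;> linarith [hx.1]
  · rcases hx with hx | hx <;> linarith [hx.2]

/-- Both directions are proved together, since the inductive step adjoins roots from both fields. -/
theorem rootTransfer (hR₁ : PolynomialIVT R₁) (hR₂ : PolynomialIVT R₂) (n : ℕ) :
    RootTransfer.{u} R₁ R₂ n := by
  suffices h : RootTransfer.{u} R₁ R₂ n ∧ RootTransfer.{u} R₂ R₁ n from h.1
  induction n with
  | zero => exact ⟨fun _ _ _ _ _ _ _ _ h => absurd h (Nat.not_lt_zero _),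
      fun _ _ _ _ _ _ _ _ h => absurd h (Nat.not_lt_zero _)⟩
  | succ n ih => exact ⟨.succ hR₁ hR₂ ih.1 ih.2, .succ hR₂ hR₁ ih.2 ih.1⟩

end Transfer

/-! ### Weighted sums of squares modulo a polynomial -/

section SumsOfSquares

variable (R : Type*) [Field R] [LinearOrder R]

/-- Sums of squares of polynomials, weighted by non-negative scalars. -/
noncomputable def weightedSquares : AddSubmonoid R[X] :=
  AddSubmonoid.closure {p | ∃ (c : R) (g : R[X]), 0 ≤ c ∧ p = C c * g ^ 2}

variable {R}

theorem C_mul_sq_mem_weightedSquares {c : R} (hc : 0 ≤ c) (g : R[X]) :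
    C c * g ^ 2 ∈ weightedSquares R :=
  AddSubmonoid.subset_closure ⟨c, g, hc, rfl⟩

/-- Each square `g ^ 2` is replaced by `(g % q) ^ 2`, with the same weight. -/
theorem exists_natDegree_le_of_mem_weightedSquares {q : R[X]} (hq : 0 < q.natDegree) {p : R[X]}
    (hp : p ∈ weightedSquares R) :
    ∃ r ∈ weightedSquares R, q ∣ p - r ∧ r.natDegree ≤ 2 * (q.natDegree - 1) := by
  induction hp using AddSubmonoid.closure_induction with
  | mem p hp =>
    obtain ⟨c, g, hc, rfl⟩ := hp
    refine ⟨C c * (g % q) ^ 2, C_mul_sq_mem_weightedSquares hc _, ?_, ?_⟩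
    · have h : q ∣ g - g % q := ⟨g / q, by linear_combination -(EuclideanDomain.div_add_mod g q)⟩
      have : C c * g ^ 2 - C c * (g % q) ^ 2 = (g - g % q) * (C c * (g + g % q)) := by ring
      rw [this]
      exact h.mul_right _
    · refine (natDegree_C_mul_le _ _).trans (natDegree_pow_le.trans ?_)
      have := natDegree_mod_lt g hq.ne'
      omega
  | zero => exact ⟨0, zero_mem _, by simp, by simp⟩
  | add p₁ p₂ _ _ h₁ h₂ =>
    obtain ⟨r₁, hr₁, hd₁, hn₁⟩ := h₁
    obtain ⟨r₂, hr₂, hd₂, hn₂⟩ := h₂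
    refine ⟨r₁ + r₂, add_mem hr₁ hr₂, ?_, (natDegree_add_le _ _).trans (max_le hn₁ hn₂)⟩
    rw [add_sub_add_comm]
    exact dvd_add hd₁ hd₂

variable [IsStrictOrderedRing R]

theorem sq_mem_weightedSquares (g : R[X]) : g ^ 2 ∈ weightedSquares R := by
  simpa using C_mul_sq_mem_weightedSquares zero_le_one g

theorem mul_mem_weightedSquares {p q : R[X]} (hp : p ∈ weightedSquares R)
    (hq : q ∈ weightedSquares R) : p * q ∈ weightedSquares R := by
  have h := AddSubmonoid.mul_mem_mul hp hq
  rw [weightedSquares, AddSubmonoid.closure_mul_closure] at h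
  refine AddSubmonoid.closure_mono ?_ h
  rintro _ ⟨_, ⟨c, g, hc, rfl⟩, _, ⟨d, k, hd, rfl⟩, rfl⟩
  exact ⟨c * d, g * k, mul_nonneg hc hd, by simp only [map_mul]; ring⟩

theorem eval_nonneg_of_mem_weightedSquares {p : R[X]} (hp : p ∈ weightedSquares R) (x : R) :
    0 ≤ p.eval x := by
  induction hp using AddSubmonoid.closure_induction with
  | mem p hp =>
    obtain ⟨c, g, hc, rfl⟩ := hp
    simp only [eval_mul, eval_C, eval_pow]
    positivity
  | zero => simp
  | add p q _ _ hp hq => simpa using add_nonneg hp hq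

/-- An irreducible polynomial that changes sign does not divide `1` plus a weighted sum of
squares. -/
theorem not_dvd_one_add_of_mem_weightedSquares {q : R[X]} (hq : Irreducible q) {a b : R}
    (hab : q.eval a * q.eval b < 0) {p : R[X]} (hp : p ∈ weightedSquares R) : ¬ q ∣ 1 + p := by
  induction hn : q.natDegree using Nat.strong_induction_on generalizing q p with
  | h n ih =>
    intro hdvd
    have hq0 : 0 < q.natDegree := hq.natDegree_pos
    -- Descent: after reduction `1 + r = q h` with `deg h < deg q`. As `1 + r` is positive
    -- everywhere, `h` changes sign together with `q`, and so does an irreducible factor of `h`,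
    -- which again divides `1 + r`.
    obtain ⟨r, hr, hpr, hrn⟩ := exists_natDegree_le_of_mem_weightedSquares hq0 hp
    have hqr : q ∣ 1 + r := by
      have := dvd_sub hdvd hpr
      rwa [show 1 + p - (p - r) = 1 + r by ring] at this
    obtain ⟨h, hh⟩ := hqr
    have hpos : ∀ x, 0 < q.eval x * h.eval x := fun x => by
      have h1 := eval_nonneg_of_mem_weightedSquares hr x
      have h2 := congrArg (eval x) hh
      simp only [eval_add, eval_one, eval_mul] at h2
      linarith
    have hneg : h.eval a * h.eval b < 0 := by
      by_contra h0
      have := mul_pos (hpos a) (hpos b)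
      nlinarith [mul_nonneg (neg_nonneg.2 hab.le) (not_lt.1 h0)]
    have hh0 : h ≠ 0 := by rintro rfl; simp at hneg
    have hdeg : h.natDegree < n := by
      have h1 : (1 + r).natDegree ≤ 2 * (q.natDegree - 1) :=
        (natDegree_add_le _ _).trans (max_le (by simp) hrn)
      rw [hh, natDegree_mul hq.ne_zero hh0] at h1
      omega
    obtain ⟨s, hs, hsh, hsab⟩ := exists_irreducible_dvd_eval_mul_eval_neg hneg
    refine ih s.natDegree ((natDegree_le_of_dvd hsh hh0).trans_lt hdeg) hs hsab hr rfl ?_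
    rw [hh]
    exact hsh.mul_left q

end SumsOfSquares

/-! ### Extension to an ordered field with the intermediate value property -/

section Cones

variable {F E : Type*} [Field F] [Field E] [Algebra F E] {P : RingPreordering F}

/-- A preordering of a subfield of `E`, namely of the field of differences, extending `P`. -/
structure IsFieldCone (P : RingPreordering F) (Q : Set E) : Prop where
  map_mem : ∀ a ∈ P, algebraMap F E a ∈ Q
  add_mem : ∀ a ∈ Q, ∀ b ∈ Q, a + b ∈ Q
  mul_mem : ∀ a ∈ Q, ∀ b ∈ Q, a * b ∈ Q
  sq_sub_mem : ∀ a ∈ Q, ∀ b ∈ Q, (a - b) ^ 2 ∈ Q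
  neg_one_notMem : -1 ∉ Q

theorem isFieldCone_image (P : RingPreordering F) :
    IsFieldCone P (algebraMap F E '' (P : Set F)) where
  map_mem a ha := ⟨a, ha, rfl⟩
  add_mem := by rintro _ ⟨a, ha, rfl⟩ _ ⟨b, hb, rfl⟩; exact ⟨a + b, add_mem ha hb, by simp⟩
  mul_mem := by rintro _ ⟨a, ha, rfl⟩ _ ⟨b, hb, rfl⟩; exact ⟨a * b, mul_mem ha hb, by simp⟩
  sq_sub_mem := by
    rintro _ ⟨a, ha, rfl⟩ _ ⟨b, hb, rfl⟩
    exact ⟨(a - b) ^ 2, P.pow_two_mem _, by simp⟩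
  neg_one_notMem := by
    rintro ⟨a, ha, h⟩
    have : a = -1 := (algebraMap F E).injective (by simpa using h)
    exact P.neg_one_notMem (this ▸ ha)

theorem exists_maximal_isFieldCone (P : RingPreordering F) (E : Type*) [Field E] [Algebra F E] :
    ∃ Q : Set E, Maximal (IsFieldCone P) Q := by
  obtain ⟨Q, -, hQ⟩ := zorn_subset_nonempty {Q : Set E | IsFieldCone P Q} (fun c hc hchain hne => by
    have hdir : ∀ a ∈ ⋃₀ c, ∀ b ∈ ⋃₀ c, ∃ s ∈ c, a ∈ s ∧ b ∈ s := by
      rintro a ⟨s, hs, ha⟩ b ⟨t, ht, hb⟩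
      rcases hchain.total hs ht with h | h
      · exact ⟨t, ht, h ha, hb⟩
      · exact ⟨s, hs, ha, h hb⟩
    refine ⟨⋃₀ c, ⟨fun a ha => ?_, fun a ha b hb => ?_, fun a ha b hb => ?_, fun a ha b hb => ?_,
      ?_⟩, fun s => Set.subset_sUnion_of_mem⟩
    · obtain ⟨s, hs⟩ := hne
      exact ⟨s, hs, (hc hs).map_mem a ha⟩
    · obtain ⟨s, hs, has, hbs⟩ := hdir a ha b hb
      exact ⟨s, hs, (hc hs).add_mem a has b hbs⟩
    · obtain ⟨s, hs, has, hbs⟩ := hdir a ha b hb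
      exact ⟨s, hs, (hc hs).mul_mem a has b hbs⟩
    · obtain ⟨s, hs, has, hbs⟩ := hdir a ha b hb
      exact ⟨s, hs, (hc hs).sq_sub_mem a has b hbs⟩
    · rintro ⟨s, hs, h⟩
      exact (hc hs).neg_one_notMem h) _ (isFieldCone_image P)
  exact ⟨Q, hQ⟩

namespace IsFieldCone

variable {Q : Set E}

theorem zero_mem (hQ : IsFieldCone P Q) : 0 ∈ Q := by
  simpa using hQ.map_mem 0 (ZeroMemClass.zero_mem P)

theorem one_mem (hQ : IsFieldCone P Q) : 1 ∈ Q := by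
  simpa using hQ.map_mem 1 (OneMemClass.one_mem P)

/-- The field of differences of a cone. -/
def differences [Algebra.IsAlgebraic F E] [HasMemOrNegMem P] (hQ : IsFieldCone P Q) :
    IntermediateField F E :=
  Subalgebra.toIntermediateField
    { carrier := {x | ∃ a ∈ Q, ∃ b ∈ Q, x = a - b}
      mul_mem' := by
        rintro _ _ ⟨a, ha, b, hb, rfl⟩ ⟨c, hc, d, hd, rfl⟩
        exact ⟨a * c + b * d, hQ.add_mem _ (hQ.mul_mem _ ha _ hc) _ (hQ.mul_mem _ hb _ hd),
          a * d + b * c, hQ.add_mem _ (hQ.mul_mem _ ha _ hd) _ (hQ.mul_mem _ hb _ hc), by ring⟩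
      add_mem' := by
        rintro _ _ ⟨a, ha, b, hb, rfl⟩ ⟨c, hc, d, hd, rfl⟩
        exact ⟨a + c, hQ.add_mem _ ha _ hc, b + d, hQ.add_mem _ hb _ hd, by ring⟩
      algebraMap_mem' := fun r => by
        rcases mem_or_neg_mem P r with h | h
        · exact ⟨_, hQ.map_mem r h, 0, hQ.zero_mem, by simp⟩
        · exact ⟨0, hQ.zero_mem, _, hQ.map_mem _ h, by simp⟩ }
    -- A subalgebra of an algebraic extension is closed under inverses.
    fun x hx => Subalgebra.inv_mem_of_algebraic _ (x := ⟨x, hx⟩)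
      (Algebra.IsAlgebraic.isAlgebraic (R := F) x)

variable [Algebra.IsAlgebraic F E] [HasMemOrNegMem P]

theorem mem_differences (hQ : IsFieldCone P Q) {x : E} :
    x ∈ hQ.differences ↔ ∃ a ∈ Q, ∃ b ∈ Q, x = a - b := Iff.rfl

theorem mem_differences_of_mem (hQ : IsFieldCone P Q) {x : E} (hx : x ∈ Q) : x ∈ hQ.differences :=
  hQ.mem_differences.2 ⟨x, hx, 0, hQ.zero_mem, by simp⟩

theorem sq_mem (hQ : IsFieldCone P Q) {x : E} (hx : x ∈ hQ.differences) : x ^ 2 ∈ Q := by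
  obtain ⟨a, ha, b, hb, rfl⟩ := hQ.mem_differences.1 hx
  exact hQ.sq_sub_mem a ha b hb

/-- Otherwise `-1 = x (-x) (x⁻¹)²` would lie in `Q`. -/
theorem eq_zero_of_mem_of_neg_mem (hQ : IsFieldCone P Q) {x : E} (h₁ : x ∈ Q)
    (h₂ : -x ∈ Q) : x = 0 := by
  by_contra hx
  refine hQ.neg_one_notMem ?_
  have h := hQ.mul_mem _ (hQ.mul_mem _ h₁ _ h₂) _
    (hQ.sq_mem (inv_mem (hQ.mem_differences_of_mem h₁)))
  have e : x * -x * x⁻¹ ^ 2 = -1 := by field_simp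
  rwa [e] at h

/-- If `a ∉ Q`, then `Q - aQ` is a cone: from `-1 = u - a v` would follow `a = (1 + u) v (v⁻¹)² ∈
Q`. By maximality it equals `Q`, and it contains `-a`. -/
theorem mem_or_neg_mem_of_maximal (hQ : IsFieldCone P Q) (hmax : Maximal (IsFieldCone P) Q) {a : E}
    (ha : a ∈ hQ.differences) : a ∈ Q ∨ -a ∈ Q := by
  by_cases haQ : a ∈ Q
  · exact .inl haQ
  right
  have hsub : ∀ x, (∃ u ∈ Q, ∃ v ∈ Q, x = u - a * v) → x ∈ hQ.differences := by
    rintro _ ⟨u, hu, v, hv, rfl⟩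
    exact sub_mem (hQ.mem_differences_of_mem hu) (MulMemClass.mul_mem ha (hQ.mem_differences_of_mem hv))
  have hcone : IsFieldCone P {x | ∃ u ∈ Q, ∃ v ∈ Q, x = u - a * v} :=
    { map_mem := fun r hr => ⟨_, hQ.map_mem r hr, 0, hQ.zero_mem, by simp⟩
      add_mem := by
        rintro _ ⟨u, hu, v, hv, rfl⟩ _ ⟨u', hu', v', hv', rfl⟩
        exact ⟨_, hQ.add_mem _ hu _ hu', _, hQ.add_mem _ hv _ hv', by ring⟩
      mul_mem := by
        rintro _ ⟨u, hu, v, hv, rfl⟩ _ ⟨u', hu', v', hv', rfl⟩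
        exact ⟨u * u' + a ^ 2 * (v * v'), hQ.add_mem _ (hQ.mul_mem _ hu _ hu') _
          (hQ.mul_mem _ (hQ.sq_mem ha) _ (hQ.mul_mem _ hv _ hv')), u * v' + v * u',
          hQ.add_mem _ (hQ.mul_mem _ hu _ hv') _ (hQ.mul_mem _ hv _ hu'), by ring⟩
      sq_sub_mem := fun x hx y hy =>
        ⟨_, hQ.sq_mem (sub_mem (hsub x hx) (hsub y hy)), 0, hQ.zero_mem, by simp⟩
      neg_one_notMem := by
        rintro ⟨u, hu, v, hv, h⟩
        have hv0 : v ≠ 0 := by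
          rintro rfl
          rw [mul_zero, sub_zero] at h
          exact hQ.neg_one_notMem (h ▸ hu)
        refine haQ ?_
        have h1 := hQ.mul_mem _ (hQ.mul_mem _ (hQ.add_mem _ hQ.one_mem _ hu) _ hv) _
          (hQ.sq_mem (inv_mem (hQ.mem_differences_of_mem hv)))
        have e : (1 + u) * v * v⁻¹ ^ 2 = a := by
          field_simp
          linear_combination -h
        rwa [e] at h1 }
  refine hmax.2 hcone (fun x hx => ⟨x, hx, 0, hQ.zero_mem, by simp⟩)
    ⟨0, hQ.zero_mem, 1, hQ.one_mem, by simp⟩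

open Classical in
/-- The linear order on the field of differences of a maximal cone. -/
theorem exists_linearOrder (hQ : IsFieldCone P Q) (hmax : Maximal (IsFieldCone P) Q) :
    ∃ (_ : LinearOrder hQ.differences) (_ : IsStrictOrderedRing hQ.differences),
      ∀ x : hQ.differences, 0 ≤ x ↔ (x : E) ∈ Q := by
  let cone : RingCone hQ.differences :=
    { carrier := {x | (x : E) ∈ Q}
      mul_mem' := fun ha hb => hQ.mul_mem _ ha _ hb
      one_mem' := hQ.one_mem
      add_mem' := fun ha hb => hQ.add_mem _ ha _ hb
      zero_mem' := hQ.zero_mem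
      eq_zero_of_mem_of_neg_mem' := fun ha hb => Subtype.ext (hQ.eq_zero_of_mem_of_neg_mem ha hb) }
  have : HasMemOrNegMem cone := ⟨fun a => hQ.mem_or_neg_mem_of_maximal hmax a.2⟩
  let := LinearOrder.mkOfAddGroupCone cone
  have : IsOrderedRing hQ.differences := IsOrderedRing.mkOfCone cone
  refine ⟨inferInstance, inferInstance, fun x => ?_⟩
  show x - 0 ∈ cone ↔ _
  rw [sub_zero]
  rfl

/-- Take a root `ξ` in `E` of a sign-changing irreducible factor `q`. Values at `ξ` of weighted sums
of squares form a cone containing `Q`, because `q` never divides `1 + G`. Maximality puts `ξ` in the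
field of differences, so `q` is linear and its root lies between `a` and `b`. -/
theorem polynomialIVT (hQ : IsFieldCone P Q) [IsAlgClosed E] (hmax : Maximal (IsFieldCone P) Q)
    [LinearOrder hQ.differences] [IsStrictOrderedRing hQ.differences]
    (hle : ∀ x : hQ.differences, 0 ≤ x ↔ (x : E) ∈ Q) : PolynomialIVT hQ.differences := by
  intro p a b hab hpab
  obtain ⟨q, hq, hqp, hqab⟩ := exists_irreducible_dvd_eval_mul_eval_neg hpab
  obtain ⟨ξ, hξ⟩ := IsAlgClosed.exists_aeval_eq_zero E q (degree_pos_of_irreducible hq).ne'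
  have hcone : IsFieldCone P {x | ∃ G ∈ weightedSquares hQ.differences, aeval ξ G = x} :=
    { map_mem := fun r hr => ⟨C (algebraMap F hQ.differences r) * 1 ^ 2,
        C_mul_sq_mem_weightedSquares ((hle _).2 (hQ.map_mem r hr)) 1, by
          simp [← IsScalarTower.algebraMap_apply]⟩
      add_mem := by
        rintro _ ⟨G, hG, rfl⟩ _ ⟨H, hH, rfl⟩
        exact ⟨G + H, AddMemClass.add_mem hG hH, by simp⟩
      mul_mem := by
        rintro _ ⟨G, hG, rfl⟩ _ ⟨H, hH, rfl⟩
        exact ⟨G * H, mul_mem_weightedSquares hG hH, by simp⟩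
      sq_sub_mem := by
        rintro _ ⟨G, hG, rfl⟩ _ ⟨H, hH, rfl⟩
        exact ⟨(G - H) ^ 2, sq_mem_weightedSquares _, by simp⟩
      neg_one_notMem := by
        rintro ⟨G, hG, h⟩
        have hnd := not_dvd_one_add_of_mem_weightedSquares hq hqab hG
        obtain ⟨u, v, huv⟩ := hq.coprime_iff_not_dvd.2 hnd
        have := congrArg (aeval ξ) huv
        simp [hξ, h] at this }
  have hQle : Q ⊆ {x | ∃ G ∈ weightedSquares hQ.differences, aeval ξ G = x} := fun x hx =>
    ⟨C ⟨x, hQ.mem_differences_of_mem hx⟩ * 1 ^ 2, C_mul_sq_mem_weightedSquares ((hle _).2 hx) 1, by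
      simp⟩
  have hle' := hmax.2 hcone hQle
  have : CharZero E := (RingHom.charZero_iff (algebraMap hQ.differences E).injective).1 inferInstance
  have hξmem : ξ ∈ hQ.differences := by
    -- This is `ξ = ((ξ + 1) / 2)² - ((ξ - 1) / 2)²`.
    refine hQ.mem_differences.2 ⟨_, hle' ⟨(C 2⁻¹ * (X + 1)) ^ 2, sq_mem_weightedSquares _, rfl⟩,
      _, hle' ⟨(C 2⁻¹ * (X - 1)) ^ 2, sq_mem_weightedSquares _, rfl⟩, ?_⟩
    simp [map_ofNat]
    ring
  have hroot : q.IsRoot ⟨ξ, hξmem⟩ := by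
    have h := hξ
    rw [show ξ = algebraMap hQ.differences E ⟨ξ, hξmem⟩ from rfl, aeval_algebraMap_apply] at h
    exact (map_eq_zero (algebraMap hQ.differences E)).1 h
  set c : hQ.differences := ⟨ξ, hξmem⟩
  obtain ⟨r, hr⟩ := dvd_iff_isRoot.2 hroot
  have hru : IsUnit r := (hq.isUnit_or_isUnit hr).resolve_left (not_isUnit_X_sub_C c)
  obtain ⟨u, hu, rfl⟩ := isUnit_iff.1 hru
  have hsign : (a - c) * (b - c) < 0 := by
    rw [hr] at hqab
    simp only [eval_mul, eval_sub, eval_X, eval_C] at hqab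
    by_contra h
    nlinarith [mul_nonneg (not_lt.1 h) (sq_nonneg u)]
  have hpc : p.eval c = 0 := eval_eq_zero_of_dvd_of_eval_eq_zero hqp hroot
  rcases mul_neg_iff.1 hsign with h | h
  · exact absurd hab (by linarith [h.1, h.2])
  · exact ⟨c, by linarith [h.1], by linarith [h.2], hpc⟩

end IsFieldCone

/-- An ordered field embeds into an ordered field whose polynomials satisfy the intermediate value
theorem. -/
theorem exists_polynomialIVT_extension {F : Type u} [Field F] (P : RingPreordering F)
    [HasMemOrNegMem P] :
    ∃ (R : Type u) (_ : Field R) (_ : LinearOrder R) (_ : IsStrictOrderedRing R) (i : F →+* R),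
      PolynomialIVT R ∧ ∀ a ∈ P, 0 ≤ i a := by
  obtain ⟨Q, hmax⟩ := exists_maximal_isFieldCone P (AlgebraicClosure F)
  have hQ : IsFieldCone P Q := hmax.1
  obtain ⟨_, _, hle⟩ := hQ.exists_linearOrder hmax
  exact ⟨hQ.differences, inferInstance, inferInstance, inferInstance,
    algebraMap F hQ.differences, hQ.polynomialIVT hmax hle, fun a ha => (hle _).2 (hQ.map_mem a ha)⟩

end Cones

section

open Filter

/-! ### Ultrapowers of the reals -/

section Ultraproduct

variable {ι : Type*} {U : Ultrafilter ι}

/-- Polynomial and endpoints lift to families, and the real intermediate value theorem applies in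
almost every coordinate. -/
theorem Filter.Germ.polynomialIVT : PolynomialIVT (Germ (U : Filter ι) ℝ) := by
  intro p a b hab hp
  let φ : (ι → ℝ) →+* Germ (U : Filter ι) ℝ := Germ.coeRingHom _
  have hφ : Function.Surjective φ := fun x => x.inductionOn fun f => ⟨f, rfl⟩
  obtain ⟨p, rfl⟩ := Polynomial.map_surjective φ hφ p
  obtain ⟨a, rfl⟩ := hφ a
  obtain ⟨b, rfl⟩ := hφ b
  rw [eval_map_apply, eval_map_apply, ← map_mul] at hp
  have hpe : ∀ (c : ι → ℝ) (s : ι),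
      p.eval c s = (p.map (Pi.evalRingHom (fun _ => ℝ) s)).eval (c s) := fun c s =>
    (eval_map_apply (Pi.evalRingHom (fun _ => ℝ) s) c).symm
  have hab' : ∀ᶠ s in U, a s < b s := Germ.coe_lt.1 hab
  have hp' : ∀ᶠ s in U, p.eval a s * p.eval b s < 0 := Germ.coe_lt.1 hp
  have hex : ∀ s, ∃ c, a s < b s → p.eval a s * p.eval b s < 0 →
      a s < c ∧ c < b s ∧ (p.map (Pi.evalRingHom (fun _ => ℝ) s)).eval c = 0 := by
    intro s
    by_cases h : a s < b s ∧ p.eval a s * p.eval b s < 0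
    · obtain ⟨h1, h2⟩ := h
      set q := p.map (Pi.evalRingHom (fun _ => ℝ) s)
      have hcont : ContinuousOn (fun x => q.eval x) (Set.Icc (a s) (b s)) := q.continuous.continuousOn
      rw [hpe, hpe] at h2
      suffices h0 : (0 : ℝ) ∈ (fun x => q.eval x) '' Set.Ioo (a s) (b s) by
        obtain ⟨c, hc, hc0⟩ := h0
        exact ⟨c, fun _ _ => ⟨hc.1, hc.2, hc0⟩⟩
      rcases mul_neg_iff.1 h2 with h | h
      · exact intermediate_value_Ioo' h1.le hcont ⟨h.2, h.1⟩
      · exact intermediate_value_Ioo h1.le hcont h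
    · exact ⟨0, fun h1 h2 => absurd ⟨h1, h2⟩ h⟩
  choose c hc using hex
  refine ⟨φ c, Germ.coe_lt.2 ?_, Germ.coe_lt.2 ?_, ?_⟩
  · filter_upwards [hab', hp'] with s h1 h2 using (hc s h1 h2).1
  · filter_upwards [hab', hp'] with s h1 h2 using (hc s h1 h2).2.1
  · rw [eval_map_apply]
    refine Germ.coe_eq.2 ?_
    filter_upwards [hab', hp'] with s h1 h2
    rw [hpe]
    exact (hc s h1 h2).2.2

variable {K : Type*} [Field K]

variable (U) in
/-- The ultraproduct of a family of real embeddings. -/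
noncomputable def germEmbedding (σ : ι → K →+* ℝ) : K →+* Germ (U : Filter ι) ℝ :=
  (Germ.coeRingHom (U : Filter ι)).comp (RingHom.pi σ)

theorem eval₂_germEmbedding (σ : ι → K →+* ℝ) (c : ι → ℝ) (q : K[X]) :
    q.eval₂ (germEmbedding U σ) (c : Germ (U : Filter ι) ℝ)
      = ((fun s => q.eval₂ (σ s) (c s) : ι → ℝ) : Germ (U : Filter ι) ℝ) := by
  have h1 : q.eval₂ (germEmbedding U σ) (c : Germ (U : Filter ι) ℝ)
      = Germ.coeRingHom (U : Filter ι) (q.eval₂ (RingHom.pi σ) c) :=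
    (hom_eval₂ q (RingHom.pi σ) (Germ.coeRingHom (U : Filter ι)) c).symm
  have h2 : q.eval₂ (RingHom.pi σ) c = fun s => q.eval₂ (σ s) (c s) :=
    funext fun s => hom_eval₂ q (RingHom.pi σ) (Pi.evalRingHom (fun _ => ℝ) s) c
  rw [h1, h2]
  rfl

end Ultraproduct

/-! ### Approximation by real embeddings and simple extensions -/

section RealApproximation

variable {R : Type*} [Field R] [LinearOrder R] [IsStrictOrderedRing R]

/-- The ordering of `K` induced by `i` is a limit of orderings induced by real embeddings. -/
def IsRealLimit {K : Type*} [Field K] (i : K →+* R) : Prop :=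
  ∀ A : Finset K, (∀ a ∈ A, 0 < i a) → ∃ σ : K →+* ℝ, ∀ a ∈ A, 0 < σ a

/-- The index set consists of the finite subsets `A` of `K`, with `σ A` positive on the positive
elements of `A`. For an ultrafilter finer than `atTop`, a given `a` belongs to almost every `A`. -/
theorem IsRealLimit.exists_germEmbedding {K : Type u} [Field K] {i : K →+* R}
    (hi : IsRealLimit i) :
    ∃ (ι : Type u) (U : Ultrafilter ι) (σ : ι → K →+* ℝ), SameOrder i (germEmbedding U σ) := by
  classical
  have hσ : ∀ A : Finset K, ∃ σ : K →+* ℝ, ∀ a ∈ A, 0 < i a → 0 < σ a := fun A => by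
    obtain ⟨σ, hσ⟩ := hi (A.filter fun a => 0 < i a) fun a ha => (Finset.mem_filter.1 ha).2
    exact ⟨σ, fun a ha h => hσ a (Finset.mem_filter.2 ⟨ha, h⟩)⟩
  choose σ hσ using hσ
  let U : Ultrafilter (Finset K) := Ultrafilter.of atTop
  have hpos : ∀ a, 0 < i a → 0 < germEmbedding U σ a := fun a ha => by
    refine Germ.coe_pos.2 (Ultrafilter.of_le atTop ?_)
    filter_upwards [eventually_ge_atTop {a}] with A hA
    exact hσ A a (Finset.singleton_subset_iff.1 hA) ha
  refine ⟨Finset K, U, σ, fun a => ⟨hpos a, fun h => ?_⟩⟩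
  rcases lt_trichotomy 0 (i a) with h1 | h1 | h1
  · exact h1
  · rw [(map_eq_zero i).1 h1.symm, map_zero] at h
    exact absurd h (lt_irrefl _)
  · have := hpos (-a) (by simpa using h1)
    rw [map_neg, neg_pos] at this
    exact absurd h (not_lt.2 this.le)

theorem IsRealLimit.exists_real_root (hR : PolynomialIVT R) {K : Type u} [Field K] {i : K →+* R}
    (hi : IsRealLimit i) {x : R} {f : K[X]} (hf : f ≠ 0) (hfx : f.eval₂ i x = 0) (A : Finset K[X])
    (hA : ∀ q ∈ A, 0 < q.eval₂ i x) :
    ∃ (σ : K →+* ℝ) (c : ℝ), f.eval₂ σ c = 0 ∧ ∀ q ∈ A, 0 < q.eval₂ σ c := by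
  obtain ⟨ι, U, σ, hσ⟩ := hi.exists_germEmbedding
  obtain ⟨c', hc'⟩ := rootTransfer hR Germ.polynomialIVT (f.natDegree + 1) K i (germEmbedding U σ) hσ
    x f hf (Nat.lt_succ_self _) hfx
  induction c' using Germ.inductionOn with
  | h c =>
    have h1 : ∀ᶠ s in U, f.eval₂ (σ s) (c s) = 0 := by
      have := (hc'.eq_zero_iff f).1 hfx
      rw [eval₂_germEmbedding] at this
      exact Germ.coe_eq.1 this
    have h2 : ∀ᶠ s in U, ∀ q ∈ A, 0 < q.eval₂ (σ s) (c s) := by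
      refine (eventually_all_finset A).2 fun q hq => ?_
      have := (hc' q).1 (hA q hq)
      rw [eval₂_germEmbedding] at this
      exact Germ.coe_pos.1 this
    obtain ⟨s, hs1, hs2⟩ := (h1.and h2).exists
    exact ⟨σ s, c s, hs1, hs2⟩

/-- Here `x` may be transcendental, so the roots of the polynomials in `A` are transferred instead.
No root separates `x` from a suitable `m` in the enlarged field, whose image replaces `x`. -/
theorem IsRealLimit.exists_real_point (hR : PolynomialIVT R) {K : Type u} [Field K] {i : K →+* R}
    (hi : IsRealLimit i) {x : R} (A : Finset K[X]) (hA : ∀ q ∈ A, 0 < q.eval₂ i x) :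
    ∃ (σ : K →+* ℝ) (c : ℝ), ∀ q ∈ A, 0 < q.eval₂ σ c := by
  classical
  obtain ⟨ι, U, σ, hσ⟩ := hi.exists_germEmbedding
  have hA0 : ∀ q ∈ A, q ≠ 0 := by
    rintro q hq rfl
    simpa using hA _ hq
  let T : Finset R := A.biUnion fun q => (q.map i).roots.toFinset
  have hmem : ∀ t, t ∈ T ↔ ∃ q ∈ A, q.eval₂ i t = 0 := fun t => by
    simp only [T, Finset.mem_biUnion, Multiset.mem_toFinset, mem_roots', IsRoot.def,
      ← eval₂_eq_eval_map, Ne, Polynomial.map_eq_zero]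
    exact ⟨fun ⟨q, hq, h⟩ => ⟨q, hq, h.2⟩, fun ⟨q, hq, h⟩ => ⟨q, hq, hA0 q hq, h⟩⟩
  obtain ⟨L, _, j, k₁, k₂, hk, rfl, hj₂, hT⟩ :=
    (rootTransfer hR Germ.polynomialIVT (A.sup natDegree + 1)).exists_extension T hσ (by
      intro t ht
      obtain ⟨q, hq, hqt⟩ := (hmem t).1 ht
      exact ⟨q, hA0 q hq, Nat.lt_succ_of_le (Finset.le_sup (f := natDegree) hq), hqt⟩)
  obtain ⟨m, hm⟩ := Finset.exists_uIcc_disjoint k₁ hT (b := x) fun hx => by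
    obtain ⟨q, hq, hqx⟩ := (hmem x).1 hx
    exact (hA q hq).ne' hqx
  have hpos : ∀ q ∈ A, 0 < q.eval₂ (germEmbedding U σ) (k₂ m) := by
    intro q hq
    have h1 : 0 < (q.map (k₁.comp j)).eval (k₁ m) := by
      refine hR.pos_of_pos (a := x) (fun t ht h0 => ?_) ?_
      · rw [← eval₂_eq_eval_map] at h0
        exact hm t ((hmem t).2 ⟨q, hq, h0⟩) (Set.uIcc_comm x _ ▸ ht)
      · rw [← eval₂_eq_eval_map]
        exact hA q hq
    rw [← hj₂, eval₂_eq_eval_map]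
    rw [← Polynomial.map_map, eval_map_apply] at h1 ⊢
    exact (hk _).1 h1
  generalize k₂ m = c' at hpos
  induction c' using Germ.inductionOn with
  | h c =>
    have h2 : ∀ᶠ s in U, ∀ q ∈ A, 0 < q.eval₂ (σ s) (c s) := by
      refine (eventually_all_finset A).2 fun q hq => ?_
      have := hpos q hq
      rw [eval₂_germEmbedding] at this
      exact Germ.coe_pos.1 this
    obtain ⟨s, hs⟩ := h2.exists
    exact ⟨σ s, c s, hs⟩

theorem Polynomial.countable (K : Type*) [Semiring K] [Countable K] : Countable K[X] := by
  rw [← Cardinal.mk_le_aleph0_iff]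
  exact cardinalMk_le_max.trans (max_le (Cardinal.mk_le_aleph0_iff.2 inferInstance) le_rfl)

/-- Strict polynomial inequalities can be solved by a transcendental number. -/
theorem exists_transcendental_of_pos {K : Type*} [Field K] [Countable K] (σ : K →+* ℝ)
    (A : Finset K[X]) {c : ℝ} (hc : ∀ q ∈ A, 0 < q.eval₂ σ c) :
    ∃ c' : ℝ, (∀ g : K[X], g.eval₂ σ c' = 0 → g = 0) ∧ ∀ q ∈ A, 0 < q.eval₂ σ c' := by
  have hopen : IsOpen {y : ℝ | ∀ q ∈ A, 0 < q.eval₂ σ y} := by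
    have : {y : ℝ | ∀ q ∈ A, 0 < q.eval₂ σ y} = ⋂ q ∈ A, {y : ℝ | 0 < q.eval₂ σ y} := by
      ext; simp
    rw [this]
    refine isOpen_biInter_finset fun q _ => isOpen_lt continuous_const ?_
    simp only [eval₂_eq_eval_map]
    exact (q.map σ).continuous
  have hcount : (⋃ g : {g : K[X] // g ≠ 0}, {y : ℝ | g.1.eval₂ σ y = 0}).Countable := by
    have := Polynomial.countable K
    refine Set.countable_iUnion fun g => ?_
    have : {y : ℝ | g.1.eval₂ σ y = 0} ⊆ ((g.1.map σ).roots.toFinset : Set ℝ) := by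
      intro y hy
      rw [Set.mem_ofPred_eq, eval₂_eq_eval_map] at hy
      simp only [Finset.mem_coe, Multiset.mem_toFinset, mem_roots', IsRoot.def]
      exact ⟨by rw [Ne, Polynomial.map_eq_zero]; exact g.2, hy⟩
    exact (Finset.countable_toSet _).mono this
  -- The solutions form a nonempty open set, and the complement of the countable set of algebraic
  -- numbers is dense.
  obtain ⟨y, hy, hyA⟩ := (hcount.dense_compl ℝ).exists_mem_open hopen ⟨c, hc⟩
  refine ⟨y, fun g hg => ?_, hyA⟩
  by_contra hg0
  exact hy (Set.mem_iUnion.2 ⟨⟨g, hg0⟩, hg⟩)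

/-- Extending a homomorphism to a field generated by one element. -/
theorem exists_ringHom_of_eval₂_eq_zero_iff {K L M : Type*} [Field K] [Field L] [Field M]
    {j : K →+* L} {x : L} (hgen : ∀ l : L, ∃ g h : K[X], h.eval₂ j x ≠ 0 ∧
      l = g.eval₂ j x / h.eval₂ j x) {σ : K →+* M} {c : M}
    (hker : ∀ g : K[X], g.eval₂ j x = 0 ↔ g.eval₂ σ c = 0) :
    ∃ τ : L →+* M, ∀ g : K[X], τ (g.eval₂ j x) = g.eval₂ σ c := by
  choose g h hh hl using hgen
  let τ : L → M := fun l => (g l).eval₂ σ c / (h l).eval₂ σ c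
  -- The value does not depend on the chosen fraction: by `hker`, cross-multiplied identities carry
  -- over.
  have hτ : ∀ p q : K[X], q.eval₂ j x ≠ 0 →
      τ (p.eval₂ j x / q.eval₂ j x) = p.eval₂ σ c / q.eval₂ σ c := by
    intro p q hq
    set l := p.eval₂ j x / q.eval₂ j x with hldef
    have h1 : (h l).eval₂ σ c ≠ 0 := mt (hker _).2 (hh l)
    have h2 : q.eval₂ σ c ≠ 0 := mt (hker _).2 hq
    have h3 := hl l
    conv_lhs at h3 => rw [hldef]
    rw [div_eq_div_iff hq (hh l), ← eval₂_mul, ← eval₂_mul, ← sub_eq_zero, ← eval₂_sub, hker,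
      eval₂_sub, eval₂_mul, eval₂_mul, sub_eq_zero] at h3
    show (g l).eval₂ σ c / (h l).eval₂ σ c = _
    rw [div_eq_div_iff h1 h2, h3]
  have hτ1 : ∀ p : K[X], τ (p.eval₂ j x) = p.eval₂ σ c := fun p => by
    simpa using hτ p 1 (by simp)
  refine ⟨{ toFun := τ, map_one' := ?_, map_zero' := ?_, map_mul' := ?_, map_add' := ?_ }, hτ1⟩
  · simpa using hτ1 1
  · intro l l'
    conv_lhs => rw [hl l, hl l', div_mul_div_comm, ← eval₂_mul, ← eval₂_mul]
    rw [hτ _ _ (by rw [eval₂_mul]; exact mul_ne_zero (hh l) (hh l')), eval₂_mul, eval₂_mul,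
      ← div_mul_div_comm]
  · simpa using hτ1 0
  · intro l l'
    have h1 := mt (hker _).2 (hh l)
    have h2 := mt (hker _).2 (hh l')
    conv_lhs => rw [hl l, hl l', div_add_div _ _ (hh l) (hh l'), ← eval₂_mul, ← eval₂_mul,
      ← eval₂_mul, ← eval₂_add]
    rw [hτ _ _ (by rw [eval₂_mul]; exact mul_ne_zero (hh l) (hh l')), eval₂_add, eval₂_mul,
      eval₂_mul, eval₂_mul, ← div_add_div _ _ h1 h2]

theorem Irreducible.eval₂_eq_zero_iff_dvd {K S : Type*} [Field K] [CommRing S] [Nontrivial S]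
    {j : K →+* S} {x : S} {f : K[X]} (hf : Irreducible f) (hfx : f.eval₂ j x = 0) (g : K[X]) :
    g.eval₂ j x = 0 ↔ f ∣ g := by
  refine ⟨fun hg => ?_, fun ⟨q, hq⟩ => by rw [hq, eval₂_mul, hfx, zero_mul]⟩
  by_contra hnd
  obtain ⟨u, v, huv⟩ := hf.coprime_iff_not_dvd.2 hnd
  simpa [eval₂_add, eval₂_mul, hfx, hg] using congrArg (eval₂ j x) huv

/-- Approximability by real embeddings passes to extensions generated by one element. -/
theorem IsRealLimit.of_simple (hR : PolynomialIVT R) {K : Type u} {L : Type*} [Field K] [Field L]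
    [Countable K] {j : K →+* L} {i : L →+* R} (hi : IsRealLimit (i.comp j)) {x : L}
    (hgen : ∀ l : L, ∃ g h : K[X], h.eval₂ j x ≠ 0 ∧ l = g.eval₂ j x / h.eval₂ j x) :
    IsRealLimit i := by
  classical
  intro A hA
  choose g h hh hl using hgen
  have hix : ∀ q : K[X], q.eval₂ (i.comp j) (i x) = i (q.eval₂ j x) := fun q =>
    (hom_eval₂ q j i x).symm
  -- A quotient `g / h` has the sign of `g h`, so positivity becomes a polynomial inequality at `x`.
  have hpos : ∀ q ∈ A.image fun l => g l * h l, 0 < q.eval₂ (i.comp j) (i x) := by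
    intro q hq
    obtain ⟨l, hlA, rfl⟩ := Finset.mem_image.1 hq
    have h1 := hA l hlA
    rw [hl l, map_div₀] at h1
    rw [hix, eval₂_mul, map_mul]
    exact mul_pos_iff.2 (div_pos_iff.1 h1)
  suffices hs : ∃ (σ : K →+* ℝ) (c : ℝ), (∀ q : K[X], q.eval₂ j x = 0 ↔ q.eval₂ σ c = 0) ∧
      ∀ q ∈ A.image fun l => g l * h l, 0 < q.eval₂ σ c by
    obtain ⟨σ, c, hker, hc⟩ := hs
    obtain ⟨τ, hτ⟩ := exists_ringHom_of_eval₂_eq_zero_iff (fun l => ⟨g l, h l, hh l, hl l⟩) hker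
    refine ⟨τ, fun l hlA => ?_⟩
    have h1 := hc _ (Finset.mem_image_of_mem _ hlA)
    rw [eval₂_mul] at h1
    rw [hl l, map_div₀, hτ, hτ]
    exact div_pos_iff.2 (mul_pos_iff.1 h1)
  by_cases halg : ∃ f : K[X], f ≠ 0 ∧ f.eval₂ j x = 0
  · obtain ⟨f, hf0, hfx⟩ := halg
    obtain ⟨f, hf, hfx⟩ := exists_irreducible_eval₂_eq_zero hf0 hfx
    obtain ⟨σ, c, hfc, hc⟩ := hi.exists_real_root hR hf.ne_zero
      (by rw [hix, hfx, map_zero]) _ hpos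
    exact ⟨σ, c, fun q => by
      rw [hf.eval₂_eq_zero_iff_dvd hfx, hf.eval₂_eq_zero_iff_dvd hfc], hc⟩
  · push Not at halg
    obtain ⟨σ, c, hc⟩ := hi.exists_real_point hR _ hpos
    obtain ⟨c', hc', hpos'⟩ := exists_transcendental_of_pos σ _ hc
    refine ⟨σ, c', fun q => ⟨fun hq => ?_, fun hq => ?_⟩, hpos'⟩
    · by_cases hq0 : q = 0
      · simp [hq0]
      · exact absurd hq (halg q hq0)
    · rw [hc' q hq, eval₂_zero]

end RealApproximation

end

/-! ### Finitely generated extensions of a countable field -/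

theorem IntermediateField.exists_eval₂_div_of_mem_adjoin_simple {F E : Type*} [Field F] [Field E]
    [Algebra F E] {x y : E} (hy : y ∈ IntermediateField.adjoin F {x}) :
    ∃ g h : F[X], h.eval₂ (algebraMap F E) x ≠ 0 ∧
      y = g.eval₂ (algebraMap F E) x / h.eval₂ (algebraMap F E) x := by
  obtain ⟨g, h, rfl⟩ := (IntermediateField.mem_adjoin_simple_iff F y).1 hy
  -- A zero denominator makes the quotient `0`, which is rewritten as `0 / 1`.
  by_cases h0 : aeval x h = 0
  · exact ⟨0, 1, by simp, by simp [h0]⟩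
  · exact ⟨g, h, h0, rfl⟩

/-- Approximability by real embeddings passes to finitely generated extensions. -/
theorem IsRealLimit.of_fg {k F R : Type*} [Field k] [Countable k] [Field F] [Algebra k F] [Field R]
    [LinearOrder R] [IsStrictOrderedRing R] (hR : PolynomialIVT R) {i : F →+* R}
    (hk : IsRealLimit (i.comp (algebraMap k F))) (hF : (⊤ : IntermediateField k F).FG) :
    IsRealLimit i := by
  classical
  -- Countability is carried through the induction, since `IsRealLimit.of_simple` needs a countable
  -- base.
  have key := IntermediateField.induction_on_adjoin_fg
    (fun K : IntermediateField k F => Countable K ∧ IsRealLimit (i.comp (algebraMap K F)))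
    (by
      let e := IntermediateField.botEquiv k F
      constructor
      · exact e.toEquiv.countable_iff.2 inferInstance
      · intro A hA
        obtain ⟨σ, hσ⟩ := hk (A.image e) (by
          intro a ha
          obtain ⟨b, hb, rfl⟩ := Finset.mem_image.1 ha
          have h := hA b hb
          obtain ⟨q, rfl⟩ := e.symm.surjective b
          rw [AlgEquiv.apply_symm_apply]
          exact h)
        exact ⟨σ.comp e.toRingEquiv.toRingHom, fun a ha => hσ _ (Finset.mem_image_of_mem _ ha)⟩)
    (fun K x ⟨hK, hlim⟩ => by
      let L := IntermediateField.adjoin K {x}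
      have hgen : ∀ l : L, ∃ g h : K[X],
          h.eval₂ (algebraMap K L) ⟨x, IntermediateField.mem_adjoin_simple_self K x⟩ ≠ 0 ∧
          l = g.eval₂ (algebraMap K L) ⟨x, IntermediateField.mem_adjoin_simple_self K x⟩ /
            h.eval₂ (algebraMap K L) ⟨x, IntermediateField.mem_adjoin_simple_self K x⟩ := by
        rintro ⟨l, hl⟩
        obtain ⟨g, h, h1, h2⟩ := IntermediateField.exists_eval₂_div_of_mem_adjoin_simple hl
        have e : ∀ p : K[X], algebraMap L F (p.eval₂ (algebraMap K L)
            ⟨x, IntermediateField.mem_adjoin_simple_self K x⟩) = p.eval₂ (algebraMap K F) x :=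
          fun p => hom_eval₂ p _ (algebraMap L F) _
        refine ⟨g, h, fun h0 => h1 ?_, (algebraMap L F).injective ?_⟩
        · rw [← e, h0, map_zero]
        · rw [map_div₀, e, e]
          exact h2
      constructor
      · have := Polynomial.countable K
        choose g h _ hl using hgen
        have hinj : Function.Injective fun l : L => (g l, h l) := by
          intro l l' hll
          rw [Prod.mk.injEq] at hll
          rw [hl l, hl l', hll.1, hll.2]
        exact hinj.countable
      · exact IsRealLimit.of_simple (j := algebraMap K L) (i := i.comp (algebraMap L F)) hR hlim hgen)
    ⊤ hF
  intro A hA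
  let e := (IntermediateField.topEquiv (F := k) (E := F)).symm
  obtain ⟨σ, hσ⟩ := key.2 (A.image e) (by
    intro a ha
    obtain ⟨b, hb, rfl⟩ := Finset.mem_image.1 ha
    exact hA b hb)
  exact ⟨σ.comp e.toRingEquiv.toRingHom, fun a ha => hσ _ (Finset.mem_image_of_mem _ ha)⟩

/-- `ℚ` has only one ordering. -/
theorem isRealLimit_rat {F R : Type*} [Field F] [Algebra ℚ F] [Field R] [LinearOrder R]
    [IsStrictOrderedRing R] (i : F →+* R) : IsRealLimit (i.comp (algebraMap ℚ F)) := fun A hA =>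
  ⟨Rat.castHom ℝ, fun a ha => by simpa using hA a ha⟩

end

/-! ### Orderings from real embeddings and the density theorem -/

namespace OrderingSpace

/-- The ordering induced by a real embedding. -/
def ofRealEmbedding {F : Type*} [Field F] (σ : F →+* ℝ) : OrderingSpace F :=
  ⟨.mk' {x | 0 ≤ σ x}
    (fun {x y} hx hy => by
      rw [Set.mem_ofPred_eq, map_add]
      exact add_nonneg hx hy)
    (fun {x y} hx hy => by
      rw [Set.mem_ofPred_eq, map_mul]
      exact mul_nonneg hx hy)
    (fun x => by
      rw [Set.mem_ofPred_eq, map_mul]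
      exact mul_self_nonneg _)
    (by simp), by
    rw [RingPreordering.isOrdering_iff]
    intro a b hab
    simp only [RingPreordering.mem_mk', Set.mem_ofPred_eq, map_neg, map_mul, neg_nonneg] at hab ⊢
    rcases mul_nonpos_iff.1 hab with h | h
    · exact .inl h.1
    · exact .inr h.2⟩

theorem mem_ofRealEmbedding {F : Type*} [Field F] {σ : F →+* ℝ} {x : F} :
    x ∈ (ofRealEmbedding σ).1 ↔ 0 ≤ σ x := Iff.rfl

theorem isArchimedean_ofRealEmbedding {F : Type*} [Field F] (σ : F →+* ℝ) :
    (ofRealEmbedding σ).IsArchimedean := fun x => by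
  obtain ⟨n, hn⟩ := exists_nat_ge (σ x)
  exact ⟨n, mem_ofRealEmbedding.2 (by simpa using hn)⟩

end OrderingSpace

theorem mainTheorem10 (F : Type*) [Field F] [Algebra ℚ F]
    (hF : (⊤ : IntermediateField ℚ F).FG) :
    Dense {P : OrderingSpace F | P.IsArchimedean} := by
  classical
  rw [(TopologicalSpace.isTopologicalBasis_of_subbasis
    (rfl : (inferInstance : TopologicalSpace (OrderingSpace F)) = _)).dense_iff]
  -- A basic open set is a finite intersection of Harrison sets, so a point `P` of it imposes
  -- finitely many conditions `a >_P 0`.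
  rintro _ ⟨S, ⟨hSfin, hS⟩, rfl⟩ ⟨P, hP⟩
  have := P.2
  obtain ⟨R, _, _, _, i, hR, hi⟩ := exists_polynomialIVT_extension P.1
  have hex : ∀ U ∈ S, ∃ a : F, a ≠ 0 ∧ U = OrderingSpace.harrisonSet a := fun U hU => hS hU
  choose! a ha using hex
  obtain ⟨σ, hσ⟩ := (isRealLimit_rat i).of_fg hR hF (hSfin.toFinset.image a) (by
    intro x hx
    obtain ⟨U, hU, rfl⟩ := Finset.mem_image.1 hx
    have hUS := hSfin.mem_toFinset.1 hU
    have hPU := hP U hUS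
    rw [(ha U hUS).2] at hPU
    exact lt_of_le_of_ne (hi _ hPU.1) ((map_ne_zero i).2 (ha U hUS).1).symm)
  refine ⟨OrderingSpace.ofRealEmbedding σ, fun U hU => ?_,
    OrderingSpace.isArchimedean_ofRealEmbedding σ⟩
  rw [(ha U hU).2]
  exact ⟨OrderingSpace.mem_ofRealEmbedding.2
    (hσ _ (Finset.mem_image_of_mem _ (hSfin.mem_toFinset.2 hU))).le, (ha U hU).1⟩
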